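/- Let $(Y,d_Y)$ be a compact metric space and $g:Y\to Y$ a continuous surjection satisfying Wieler's axioms: there are constants $\beta>0$, an integer $K\ge 1$ and $0<\gamma<1$ such that (1) if $d_Y(x,y)\le\beta$, then $d_Y(g^K(x),g^K(y))\le\gamma^K d_Y(g^{2K}(x),g^{2K}(y))$; (2) for all $x\in Y$ and $0<\epsilon\le\beta$, $g^K(B(g^K(x),\epsilon))\subseteq g^{2K}(B(x,\gamma\epsilon))$ (open balls). Let $X=\{(x_n)_{n\ge0}\in Y^{\mathbb N}: g(x_{n+1})=x_n \text{ for all } n\}$ with the product topology, $\varphi:X\to X$, $\varphi(x_0,x_1,\dots)=(g(x_0),g(x_1),\dots)$, and $$d_X(x,y)=\sum_{i=0}^{K}\gamma^i\, d'_X(\varphi^i(x),\varphi^i(y)),\qquad d'_X(x,y)=\sup_{n}\gamma^n d_Y(x_n,y_n).$$ For $x\in X$ and $0<\delta\le\beta/2$ put $X^u(x,\delta)=\{y\in X: d_Y(x_n,y_n)<\delta\ \text{for all } n,\ d_X(x,y)<\delta\}$, and write $x\sim_u y$ if $d_X(\varphi^{-n}(x),\varphi^{-n}(y))\to0$ as $n\to\infty$.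 Let $P\subseteq X$ be a finite set of $\varphi$-periodic points with $\varphi(P)=P$, and let $X^u(P)=\{x\in X: x\sim_u p \text{ for some } p\in P\}$, with the topology generated by the sets $X^u(x,\delta)$, $x\in X^u(P)$, $0<\delta\le\beta/2$. Let $\pi_0(x)=x_0$ and fix $0<\epsilon_Y\le\beta/2$. For $x,y\in X^u(P)$ write $x\sim_0y$ if $x_0=y_0$ and there are $0<\delta<\epsilon_Y$ and an open set $U\subseteq X^u(y,\epsilon_Y)$ of $X^u(P)$ with $\pi_0(X^u(x,\delta))=\pi_0(U)$. Then $\sim_0$ is an equivalence relation; the quotient space $X^u(P)/{\sim_0}$ is compact and locally Hausdorff; and $\tilde g([x])=[\varphi(x)]$ is a well-defined surjection of $X^u(P)/{\sim_0}$ onto itself. Moreover, with $r:X^u(P)/{\sim_0}\to Y$, $r([x])=x_0$: (a) $\tilde g$ is forward orbit expansive: there is a finite open cover $U_1,\dots,U_l$ of $X^u(P)/{\sim_0}$ such that if, for every $n\ge0$, some $U_i$ contains both $\tilde g^n(a)$ and $\tilde g^n(b)$, then $a=b$. (b) $\tilde g$ is a local homeomorphism. (c) There is $L\in\mathbb N$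 such that $\tilde g^L(r^{-1}(y))$ is a singleton for every $y$ in the image of $r$, and $\tilde g^L(\tilde r^{-1}(y))$ is a singleton for every point $y$ of the largest Hausdorff quotient $\tilde r: X^u(P)/{\sim_0}\to (X^u(P)/{\sim_0})_{\rm Haus}$. If, in addition, $P\neq\emptyset$ and $(X,\varphi)$ is irreducible (for all non-empty open $U,V\subseteq X$ there is $n>0$ with $\varphi^n(U)\cap V\ne\emptyset$), then with the same $L$ the set $\tilde g^L(r^{-1}(y))$ is a singleton for every $y\in Y$. -/

import Mathlib

open Set Filter Topology

noncomputable section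

/-- A Wieler pre-solenoid: a continuous surjection `g` of a compact metric space `Y`, together with
constants `β`, `K`, `γ` for which Wieler's two axioms hold. -/
structure WielerPresolenoid (Y : Type*) [MetricSpace Y] [CompactSpace Y] where
  g : Y → Y
  continuous_g : Continuous g
  surjective_g : Function.Surjective g
  β : ℝ
  β_pos : 0 < β
  K : ℕ
  K_pos : 0 < K
  γ : ℝ
  γ_pos : 0 < γ
  γ_lt_one : γ < 1
  axiom_one : ∀ x y : Y, dist x y ≤ β →
    dist (g^[K] x) (g^[K] y) ≤ γ ^ K * dist (g^[2 * K] x) (g^[2 * K] y)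
  axiom_two : ∀ (x : Y) (ε : ℝ), 0 < ε → ε ≤ β →
    g^[K] '' Metric.ball (g^[K] x) ε ⊆ g^[2 * K] '' Metric.ball x (γ * ε)

namespace WielerPresolenoid

variable {Y : Type*} [MetricSpace Y] [CompactSpace Y] (W : WielerPresolenoid Y)

/-- The inverse limit `X` of `Y` under `g`; as a subtype it carries the topology induced by the
product topology on `ℕ → Y`. -/
abbrev Solenoid : Type _ := {x : ℕ → Y // ∀ i, W.g (x (i + 1)) = x i}

/-- The homeomorphism `φ` of the solenoid, as a bijection: `φ x = (g x₀, g x₁, g x₂, …)`, with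
inverse the left shift. -/
def φ : W.Solenoid ≃ W.Solenoid where
  toFun x := ⟨fun n => W.g (x.1 n), fun i => congrArg W.g (x.2 i)⟩
  invFun x := ⟨fun n => x.1 (n + 1), fun i => x.2 (i + 1)⟩
  left_inv x := Subtype.ext (funext fun n => x.2 n)
  right_inv x := Subtype.ext (funext fun n => x.2 n)

/-- `d'_X(x, y) = sup_n γⁿ d_Y(xₙ, yₙ)`. -/
def dX' (x y : W.Solenoid) : ℝ := ⨆ n : ℕ, W.γ ^ n * dist (x.1 n) (y.1 n)

/-- `d_X(x, y) = ∑_{i=0}^{K} γⁱ d'_X(φⁱ x, φⁱ y)`. -/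
def dX (x y : W.Solenoid) : ℝ :=
  ∑ i ∈ Finset.range (W.K + 1), W.γ ^ i * W.dX' (W.φ^[i] x) (W.φ^[i] y)

/-- The local unstable set `X^u(x, ε)` of the solenoid (used for `0 < ε ≤ β / 2`). -/
def localUnstable (x : W.Solenoid) (ε : ℝ) : Set W.Solenoid :=
  {y | (∀ n, dist (x.1 n) (y.1 n) < ε) ∧ W.dX x y < ε}

/-- Unstable equivalence: `d_X(φ⁻ⁿ x, φ⁻ⁿ y) → 0`. -/
def UnstableEquiv (x y : W.Solenoid) : Prop :=
  Tendsto (fun n : ℕ => W.dX (W.φ.symm^[n] x) (W.φ.symm^[n] y)) atTop (𝓝 0)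

/-- The set `X^u(P)` of points unstably equivalent to a point of `P`. It is a structure and not a
subtype, since its topology is finer than the subspace topology from the solenoid. -/
structure Unstable (P : Set W.Solenoid) where
  pt : W.Solenoid
  unstable : ∃ p ∈ P, W.UnstableEquiv pt p

variable {W} {P : Set W.Solenoid}

/-- `X^u(x, ε)` as a subset of `X^u(P)`, for `x` in `X^u(P)`. -/
def Unstable.ball (x : W.Unstable P) (ε : ℝ) : Set (W.Unstable P) :=
  {y | y.pt ∈ W.localUnstable x.pt ε}

/-- The topology of `X^u(P)` is generated by the local unstable sets. -/
instance : TopologicalSpace (W.Unstable P) :=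
  TopologicalSpace.generateFrom
    {U | ∃ (x : W.Unstable P) (δ : ℝ), 0 < δ ∧ δ ≤ W.β / 2 ∧ U = x.ball δ}

/-- The map `π₀ : X^u(P) → Y`, `x ↦ x₀`. -/
def Unstable.π₀ (x : W.Unstable P) : Y := x.pt.1 0

theorem UnstableEquiv.map {x y : W.Solenoid} (h : W.UnstableEquiv x y) :
    W.UnstableEquiv (W.φ x) (W.φ y) := by
  unfold UnstableEquiv at h ⊢
  rw [← tendsto_add_atTop_iff_nat 1]
  simpa [Function.iterate_succ_apply] using h

/-- The restriction of `φ` to `X^u(P)`, for a `φ`-invariant set `P`. -/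
def Unstable.map (hP : W.φ '' P = P) (x : W.Unstable P) : W.Unstable P where
  pt := W.φ x.pt
  unstable := by
    obtain ⟨p, hp, h⟩ := x.unstable
    exact ⟨W.φ p, hP ▸ mem_image_of_mem W.φ hp, h.map⟩

variable (W P)

/-- The relation `x ∼₀ y` on `X^u(P)`, with `ε` the global constant `ε_Y`. -/
def Rel₀ (ε : ℝ) (x y : W.Unstable P) : Prop :=
  x.π₀ = y.π₀ ∧ ∃ δ : ℝ, 0 < δ ∧ δ < ε ∧ ∃ U : Set (W.Unstable P),
    IsOpen U ∧ U ⊆ y.ball ε ∧ Unstable.π₀ '' x.ball δ = Unstable.π₀ '' U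

/-- The space `X^u(P)/∼₀` with the quotient topology. -/
abbrev Quotient₀ (ε : ℝ) : Type _ := Quot (W.Rel₀ P ε)

/-- The map `r : X^u(P)/∼₀ → Y`, `[x] ↦ x₀`. -/
def r (ε : ℝ) : W.Quotient₀ P ε → Y :=
  Quot.lift Unstable.π₀ fun _ _ h => h.1

/-- `(X, φ)` is irreducible. -/
def Irreducible : Prop :=
  ∀ U V : Set W.Solenoid, IsOpen U → U.Nonempty → IsOpen V → V.Nonempty →
    ∃ n : ℕ, 0 < n ∧ (W.φ^[n] '' U ∩ V).Nonempty

end WielerPresolenoid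

/-- Forward orbit expansiveness of a self-map of a (possibly non-Hausdorff) space. -/
def ForwardOrbitExpansive {Z : Type*} [TopologicalSpace Z] (f : Z → Z) : Prop :=
  ∃ (l : ℕ) (U : Fin l → Set Z), (∀ i, IsOpen (U i)) ∧ (⋃ i, U i) = univ ∧
    ∀ x y : Z, (∀ n : ℕ, ∃ i, f^[n] x ∈ U i ∧ f^[n] y ∈ U i) → x = y

/-- Every point has a Hausdorff open neighbourhood. -/
def LocallyHausdorff (Z : Type*) [TopologicalSpace Z] : Prop :=
  ∀ z : Z, ∃ U : Set Z, IsOpen U ∧ z ∈ U ∧ T2Space U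

end

/-!
The relation `∼₀` is governed by germs. For `x` in `X^u(P)` let `F x = map π₀ (𝓝 x)` be the
filter on `Y` generated by the images under `π₀` of the neighbourhoods of `x`. Three facts carry
the argument.

* `π₀` is injective, and in fact an embedding, on every local unstable set of radius at most `β
  / 2`: by Wieler's first axiom, `d(x_{n+K}, y_{n+K}) ≤ γ^K d(x_n, y_n)` there
  (`dist_add_K_le`), so the zeroth coordinate controls all the others uniformly. Hence `F x` is
  the trace `𝓝[A] x₀` on the image `A` of any open piece of a local unstable set around `x`
  (`Unstable.map_π₀_nhds`), and `x ∼₀ y` holds if and only if `F x = F y` (`Rel₀_iff`). In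
  particular `∼₀` does not depend on `ε_Y` and is an equivalence relation. Two sets with the
  same germ at a point have the same germ at nearby points, so the quotient map is open
  (`isOpenMap_toQuotient₀`).
* By Wieler's second axiom, every point of `g^K (B(x_K, δ))` lifts to the local unstable set of
  `x`, uniformly in `x` (`exists_lift`). Hence `F x = map g^K (𝓝 x_K)`
  (`Unstable.map_π₀_nhds_eq_map_iterate`), so that the class of `x` depends on `x_K` alone.
* Closed local unstable sets are compact (`Unstable.isCompact_setOf_forall_dist_le`).

The class of `φ^K x` thus depends on `x₀` alone. This gives `L = K` in the statement on fibres;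
the fibres of the largest Hausdorff quotient lie in those of `r`, since `Y` is Hausdorff.
Combined with a finite `δ`-net of the coordinates `x_K`, it shows that finitely many images of
closed local unstable sets cover the quotient. Both `r` and `g̃` are injective on the open image
of a small local unstable set; this makes the quotient locally Hausdorff and the continuous open
map `g̃` a local homeomorphism. A finite cover by such images is expansive: if two orbits stay
together in it, their images in `Y` stay `β`-close, hence agree from time `K` on by the first
axiom, hence so do the orbits themselves, and injectivity of `g̃` on the members of the cover
brings the equality back to time `0`.
-/

namespace WielerPresolenoid

variable {Y : Type*} [MetricSpace Y] [CompactSpace Y] (W : WielerPresolenoid Y)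

/-! ### Coordinates of points of the solenoid -/

theorem iterate_coord (x : W.Solenoid) (i n : ℕ) : W.g^[i] (x.1 (n + i)) = x.1 n := by
  induction i with
  | zero => rfl
  | succ i ih => rw [Function.iterate_succ_apply, ← Nat.add_assoc, x.2, ih]

theorem φ_iterate_coord (x : W.Solenoid) (i n : ℕ) : (W.φ^[i] x).1 n = W.g^[i] (x.1 n) := by
  induction i with
  | zero => rfl
  | succ i ih =>
    rw [Function.iterate_succ_apply', Function.iterate_succ_apply', ← ih]
    rfl

theorem φ_iterate_coord_of_le (x : W.Solenoid) {i n : ℕ} (h : i ≤ n) :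
    (W.φ^[i] x).1 n = x.1 (n - i) := by
  rw [φ_iterate_coord]
  conv_lhs => rw [← Nat.sub_add_cancel h]
  exact W.iterate_coord x i (n - i)

theorem φ_symm_iterate_coord (x : W.Solenoid) (i n : ℕ) :
    (W.φ.symm^[i] x).1 n = x.1 (n + i) := by
  induction i generalizing n with
  | zero => rfl
  | succ i ih =>
    rw [Function.iterate_succ_apply']
    change (W.φ.symm^[i] x).1 (n + 1) = _
    rw [ih, show n + 1 + i = n + (i + 1) by omega]

/-- A backward orbit of `g^K` interpolates to a point of the solenoid. -/
theorem exists_solenoid_of_iterate {u : ℕ → Y} (hu : ∀ j, W.g^[W.K] (u (j + 1)) = u j) :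
    ∃ z : W.Solenoid, ∀ j, z.1 (j * W.K) = u j := by
  have hK := W.K_pos
  have key : ∀ m j, W.g^[m * W.K] (u (j + m)) = u j := by
    intro m
    induction m with
    | zero => intro j; simp
    | succ m ih =>
      intro j
      rw [Nat.succ_mul, Function.iterate_add_apply, ← Nat.add_assoc, hu, ih]
  refine ⟨⟨fun n => W.g^[n * W.K - n] (u n), fun n => ?_⟩, fun j => ?_⟩
  · have hn : n ≤ n * W.K := Nat.le_mul_of_pos_right n hK
    rw [← Function.iterate_succ_apply' W.g,
      show ((n + 1) * W.K - (n + 1)).succ = (n * W.K - n) + W.K by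
        rw [Nat.succ_mul]; omega,
      Function.iterate_add_apply, hu]
  · have hj : j ≤ j * W.K := Nat.le_mul_of_pos_right j hK
    have := key (j * W.K - j) j
    rwa [Nat.add_sub_cancel' hj, Nat.sub_mul] at this

theorem exists_solenoid_coord_zero (y : Y) : ∃ z : W.Solenoid, z.1 0 = y := by
  obtain ⟨s, hs⟩ := W.surjective_g.hasRightInverse
  refine ⟨⟨fun n => s^[n] y, fun n => ?_⟩, rfl⟩
  simp only [Function.iterate_succ_apply', hs _]

/-! ### The metric `d_X` and uniform estimates -/

theorem bddAbove_dX' (x y : W.Solenoid) :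
    BddAbove (range fun n : ℕ => W.γ ^ n * dist (x.1 n) (y.1 n)) := by
  refine ⟨Metric.diam (univ : Set Y), ?_⟩
  rintro _ ⟨n, rfl⟩
  calc W.γ ^ n * dist (x.1 n) (y.1 n) ≤ 1 * dist (x.1 n) (y.1 n) := by
        gcongr
        exact pow_le_one₀ W.γ_pos.le W.γ_lt_one.le
    _ ≤ _ := by
        rw [one_mul]
        exact Metric.dist_le_diam_of_mem isCompact_univ.isBounded (mem_univ _) (mem_univ _)

theorem dX'_nonneg (x y : W.Solenoid) : 0 ≤ W.dX' x y :=
  Real.iSup_nonneg fun _ => mul_nonneg (pow_nonneg W.γ_pos.le _) dist_nonneg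

theorem dX'_triangle (x y z : W.Solenoid) : W.dX' x z ≤ W.dX' x y + W.dX' y z := by
  refine ciSup_le fun n => ?_
  calc W.γ ^ n * dist (x.1 n) (z.1 n)
      ≤ W.γ ^ n * dist (x.1 n) (y.1 n) + W.γ ^ n * dist (y.1 n) (z.1 n) := by
        rw [← mul_add]
        exact mul_le_mul_of_nonneg_left (dist_triangle _ _ _) (pow_nonneg W.γ_pos.le _)
    _ ≤ _ := add_le_add (le_ciSup (W.bddAbove_dX' x y) n) (le_ciSup (W.bddAbove_dX' y z) n)

theorem dX'_le {x y : W.Solenoid} {c : ℝ} (h : ∀ n, dist (x.1 n) (y.1 n) ≤ c) :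
    W.dX' x y ≤ c := by
  refine ciSup_le fun n => ?_
  calc W.γ ^ n * dist (x.1 n) (y.1 n) ≤ 1 * dist (x.1 n) (y.1 n) := by
        gcongr
        exact pow_le_one₀ W.γ_pos.le W.γ_lt_one.le
    _ ≤ c := by rw [one_mul]; exact h n

theorem dX_nonneg (x y : W.Solenoid) : 0 ≤ W.dX x y :=
  Finset.sum_nonneg fun _ _ => mul_nonneg (pow_nonneg W.γ_pos.le _) (W.dX'_nonneg _ _)

theorem dX_triangle (x y z : W.Solenoid) : W.dX x z ≤ W.dX x y + W.dX y z := by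
  unfold dX
  rw [← Finset.sum_add_distrib]
  refine Finset.sum_le_sum fun i _ => ?_
  rw [← mul_add]
  exact mul_le_mul_of_nonneg_left (W.dX'_triangle _ _ _) (pow_nonneg W.γ_pos.le _)

theorem exists_modulus_iterate (N : ℕ) {η : ℝ} (hη : 0 < η) :
    ∃ δ, 0 < δ ∧ ∀ i ≤ N, ∀ a b : Y, dist a b < δ → dist (W.g^[i] a) (W.g^[i] b) < η := by
  induction N with
  | zero =>
    refine ⟨η, hη, fun i hi a b h => ?_⟩
    obtain rfl := Nat.le_zero.mp hi
    exact h
  | succ N ih =>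
    obtain ⟨δ₁, h₁, H₁⟩ := ih
    have hu : UniformContinuous W.g^[N + 1] :=
      CompactSpace.uniformContinuous_of_continuous (W.continuous_g.iterate _)
    obtain ⟨δ₂, h₂, H₂⟩ := Metric.uniformContinuous_iff.mp hu η hη
    refine ⟨min δ₁ δ₂, lt_min h₁ h₂, fun i hi a b h => ?_⟩
    rcases Nat.le_succ_iff.mp hi with hi | rfl
    · exact H₁ i hi a b (h.trans_le (min_le_left _ _))
    · exact H₂ (h.trans_le (min_le_right _ _))

/-- Uniform closeness of all coordinates controls `d_X`, although `d_X` also involves the forward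
images under `φ`, by uniform continuity of the iterates of `g`. -/
theorem exists_mem_localUnstable_of_forall_dist_lt {η : ℝ} (hη : 0 < η) :
    ∃ δ, 0 < δ ∧ ∀ x y : W.Solenoid, (∀ n, dist (x.1 n) (y.1 n) < δ) →
      y ∈ W.localUnstable x η := by
  have hK : (0 : ℝ) < W.K + 2 := by positivity
  obtain ⟨δ, hδ, H⟩ := W.exists_modulus_iterate W.K (div_pos hη hK)
  refine ⟨min δ η, lt_min hδ hη, fun x y h => ⟨fun n => (h n).trans_le (min_le_right _ _), ?_⟩⟩
  calc W.dX x y ≤ ∑ i ∈ Finset.range (W.K + 1), η / (W.K + 2) := by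
        refine Finset.sum_le_sum fun i hi => ?_
        have h1 : W.dX' (W.φ^[i] x) (W.φ^[i] y) ≤ η / (W.K + 2) := by
          refine W.dX'_le fun n => ?_
          rw [φ_iterate_coord, φ_iterate_coord]
          exact (H i (Nat.lt_succ_iff.mp (Finset.mem_range.mp hi)) _ _
            ((h n).trans_le (min_le_left _ _))).le
        calc W.γ ^ i * W.dX' (W.φ^[i] x) (W.φ^[i] y)
            ≤ 1 * W.dX' (W.φ^[i] x) (W.φ^[i] y) :=
              mul_le_mul_of_nonneg_right (pow_le_one₀ W.γ_pos.le W.γ_lt_one.le)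
                (W.dX'_nonneg _ _)
          _ ≤ _ := by rwa [one_mul]
    _ = (W.K + 1) / (W.K + 2) * η := by
        rw [Finset.sum_const, Finset.card_range, nsmul_eq_mul]
        push_cast
        ring
    _ < 1 * η := by
        refine mul_lt_mul_of_pos_right ?_ hη
        rw [div_lt_one hK]
        linarith
    _ = η := one_mul η

/-- Control of every `K`-th coordinate gives control of all coordinates. -/
theorem exists_forall_dist_lt_of_forall_mul {η : ℝ} (hη : 0 < η) :
    ∃ δ, 0 < δ ∧ ∀ x y : W.Solenoid,
      (∀ j, dist (x.1 (j * W.K)) (y.1 (j * W.K)) < δ) → ∀ n, dist (x.1 n) (y.1 n) < η := by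
  obtain ⟨δ, hδ, H⟩ := W.exists_modulus_iterate W.K hη
  refine ⟨δ, hδ, fun x y h n => ?_⟩
  have hn : n + (W.K - n % W.K) = (n / W.K + 1) * W.K := by
    have h1 := Nat.div_add_mod' n W.K
    have h2 := Nat.mod_lt n W.K_pos
    rw [Nat.succ_mul]
    omega
  have := H (W.K - n % W.K) (Nat.sub_le _ _) _ _ (h (n / W.K + 1))
  rwa [← hn, iterate_coord, iterate_coord] at this

variable {W} in
/-- Wieler's first axiom, read in the solenoid: the inverse of `φ` contracts local unstable sets. -/
theorem dist_add_K_le {x y : W.Solenoid} (h : ∀ n, dist (x.1 n) (y.1 n) ≤ W.β) (n : ℕ) :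
    dist (x.1 (n + W.K)) (y.1 (n + W.K)) ≤ W.γ ^ W.K * dist (x.1 n) (y.1 n) := by
  have := W.axiom_one _ _ (h (n + W.K + W.K))
  rw [iterate_coord, iterate_coord] at this
  rwa [Nat.add_assoc, ← two_mul, iterate_coord, iterate_coord] at this

variable {W} in
theorem dist_mul_K_le {x y : W.Solenoid} (h : ∀ n, dist (x.1 n) (y.1 n) ≤ W.β) (j : ℕ) :
    dist (x.1 (j * W.K)) (y.1 (j * W.K)) ≤ (W.γ ^ W.K) ^ j * dist (x.1 0) (y.1 0) := by
  induction j with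
  | zero => simp
  | succ j ih =>
    rw [Nat.succ_mul, pow_succ', mul_assoc]
    exact (dist_add_K_le h _).trans (mul_le_mul_of_nonneg_left ih (pow_nonneg W.γ_pos.le _))

theorem γ_pow_K_lt_one : W.γ ^ W.K < 1 := pow_lt_one₀ W.γ_pos.le W.γ_lt_one W.K_pos.ne'

/-- Within a local unstable set the zeroth coordinate controls the whole point, uniformly. -/
theorem exists_mem_localUnstable_of_dist_zero_lt {η : ℝ} (hη : 0 < η) :
    ∃ δ, 0 < δ ∧ ∀ x y : W.Solenoid, (∀ n, dist (x.1 n) (y.1 n) ≤ W.β) →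
      dist (x.1 0) (y.1 0) < δ → y ∈ W.localUnstable x η := by
  obtain ⟨δ₁, h₁, H₁⟩ := W.exists_mem_localUnstable_of_forall_dist_lt hη
  obtain ⟨δ₂, h₂, H₂⟩ := W.exists_forall_dist_lt_of_forall_mul h₁
  refine ⟨δ₂, h₂, fun x y h h0 => H₁ x y (H₂ x y fun j => ?_)⟩
  refine (dist_mul_K_le h j).trans_lt (lt_of_le_of_lt ?_ h0)
  exact mul_le_of_le_one_left dist_nonneg
    (pow_le_one₀ (pow_nonneg W.γ_pos.le _) W.γ_pow_K_lt_one.le)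

variable {W} in
theorem unstableEquiv_of_forall_dist_le {x y : W.Solenoid}
    (h : ∀ n, dist (x.1 n) (y.1 n) ≤ W.β) : W.UnstableEquiv x y := by
  rw [UnstableEquiv, Metric.tendsto_atTop]
  intro η hη
  have hlim : Tendsto (fun j : ℕ => (W.γ ^ W.K) ^ j * dist (x.1 0) (y.1 0)) atTop (𝓝 0) := by
    simpa using (tendsto_pow_atTop_nhds_zero_of_lt_one (pow_nonneg W.γ_pos.le _)
      W.γ_pow_K_lt_one).mul_const (dist (x.1 0) (y.1 0))
  obtain ⟨δ₁, h₁, H₁⟩ := W.exists_mem_localUnstable_of_forall_dist_lt hη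
  obtain ⟨δ₂, h₂, H₂⟩ := W.exists_mem_localUnstable_of_dist_zero_lt h₁
  obtain ⟨j, hj⟩ := ((tendsto_order.mp hlim).2 δ₂ h₂).exists
  have hclose := (H₂ (W.φ.symm^[j * W.K] x) (W.φ.symm^[j * W.K] y)
    (fun n => by simpa only [φ_symm_iterate_coord] using h _)
    (by
      rw [φ_symm_iterate_coord, φ_symm_iterate_coord, Nat.zero_add]
      exact (dist_mul_K_le h j).trans_lt hj)).1
  refine ⟨j * W.K, fun n hn => ?_⟩
  rw [Real.dist_0_eq_abs, abs_of_nonneg (W.dX_nonneg _ _)]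
  refine (H₁ _ _ fun k => ?_).2
  have := hclose (k + (n - j * W.K))
  rw [φ_symm_iterate_coord, φ_symm_iterate_coord] at this ⊢
  rwa [Nat.add_assoc, Nat.sub_add_cancel hn] at this

/-- Wieler's second axiom, read in the solenoid: the image under `g^K` of a small ball around `x_K`
lifts to a local unstable set of `x`, uniformly in `x`. -/
theorem exists_lift {η : ℝ} (hη : 0 < η) :
    ∃ δ, 0 < δ ∧ ∀ (x : W.Solenoid) (v : Y), dist v (x.1 W.K) < δ →
      ∃ z ∈ W.localUnstable x η, z.1 0 = W.g^[W.K] v := by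
  obtain ⟨δ₁, h₁, H₁⟩ := W.exists_mem_localUnstable_of_forall_dist_lt hη
  obtain ⟨δ₂, h₂, H₂⟩ := W.exists_forall_dist_lt_of_forall_mul h₁
  obtain ⟨δ₃, h₃, H₃⟩ := W.exists_modulus_iterate W.K h₂
  have hδ : 0 < min δ₃ W.β := lt_min h₃ W.β_pos
  refine ⟨min δ₃ W.β, hδ, fun x v hv => ?_⟩
  set δ := min δ₃ W.β
  have step : ∀ (j : ℕ) (w : Y), dist w (x.1 ((j + 1) * W.K)) < δ →
      ∃ w', dist w' (x.1 ((j + 1 + 1) * W.K)) < δ ∧ W.g^[2 * W.K] w' = W.g^[W.K] w := by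
    intro j w hw
    have hx : W.g^[W.K] (x.1 ((j + 1 + 1) * W.K)) = x.1 ((j + 1) * W.K) := by
      rw [Nat.succ_mul (j + 1), iterate_coord]
    obtain ⟨w', hw', e⟩ := W.axiom_two (x.1 ((j + 1 + 1) * W.K)) δ hδ (min_le_right _ _)
      ⟨w, by rw [hx]; exact hw, rfl⟩
    refine ⟨w', lt_of_lt_of_le hw' ?_, e⟩
    exact mul_le_of_le_one_left hδ.le W.γ_lt_one.le
  choose! s hs hs' using step
  let w : ℕ → Y := fun n => Nat.rec v s n
  have hw : ∀ j, dist (w j) (x.1 ((j + 1) * W.K)) < δ := by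
    intro j
    induction j with
    | zero => simpa [w] using hv
    | succ j ih => exact hs j _ ih
  obtain ⟨z, hz⟩ := W.exists_solenoid_of_iterate (u := fun j => W.g^[W.K] (w j)) fun j => by
    rw [← Function.iterate_add_apply, ← two_mul]
    exact hs' j _ (hw j)
  refine ⟨z, H₁ x z (H₂ x z fun j => ?_), by simpa [w] using hz 0⟩
  have := H₃ W.K le_rfl _ _ ((hw j).trans_le (min_le_left _ _))
  rw [Nat.succ_mul, iterate_coord] at this
  rwa [hz, dist_comm]

end WielerPresolenoid

namespace WielerPresolenoid

variable {Y : Type*} [MetricSpace Y] [CompactSpace Y] {W : WielerPresolenoid Y}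
  {P : Set W.Solenoid}

/-! ### The topology of the unstable space -/

theorem UnstableEquiv.trans {x y z : W.Solenoid} (h : W.UnstableEquiv x y)
    (h' : W.UnstableEquiv y z) : W.UnstableEquiv x z := by
  unfold UnstableEquiv at *
  refine squeeze_zero (fun _ => W.dX_nonneg _ _) (fun n => W.dX_triangle _ (W.φ.symm^[n] y) _) ?_
  simpa using h.add h'

theorem UnstableEquiv.map_symm {x y : W.Solenoid} (h : W.UnstableEquiv x y) :
    W.UnstableEquiv (W.φ.symm x) (W.φ.symm y) := by
  unfold UnstableEquiv at h ⊢
  simpa [Function.iterate_succ_apply] using (tendsto_add_atTop_iff_nat 1).mpr h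

namespace Unstable

@[ext]
theorem ext {x y : W.Unstable P} (h : x.pt = y.pt) : x = y := by
  cases x
  cases y
  simpa using h

theorem mem_ball_self (x : W.Unstable P) {δ : ℝ} (hδ : 0 < δ) : x ∈ x.ball δ := by
  refine ⟨fun n => by simpa using hδ, ?_⟩
  simpa [dX, dX'] using hδ

theorem ball_mono (x : W.Unstable P) {δ δ' : ℝ} (h : δ ≤ δ') : x.ball δ ⊆ x.ball δ' :=
  fun _ hy => ⟨fun n => (hy.1 n).trans_le h, hy.2.trans_le h⟩

theorem forall_dist_le_of_mem_ball {x y : W.Unstable P} {δ : ℝ} (hδ : δ ≤ W.β)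
    (h : y ∈ x.ball δ) (n : ℕ) : dist (x.pt.1 n) (y.pt.1 n) ≤ W.β :=
  ((h.1 n).trans_le hδ).le

theorem forall_dist_le_of_mem_ball_of_mem_ball {x y z : W.Unstable P} {δ : ℝ}
    (hδ : δ ≤ W.β / 2) (hy : y ∈ x.ball δ) (hz : z ∈ x.ball δ) (n : ℕ) :
    dist (y.pt.1 n) (z.pt.1 n) ≤ W.β := by
  have h1 := hy.1 n
  have h2 := hz.1 n
  have h3 := dist_triangle_left (y.pt.1 n) (z.pt.1 n) (x.pt.1 n)
  linarith

/-- A point near a point of `X^u(P)` in the uniform sense lies in `X^u(P)`. -/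
theorem exists_of_forall_dist_le (x : W.Unstable P) {z : W.Solenoid}
    (h : ∀ n, dist (x.pt.1 n) (z.1 n) ≤ W.β) : ∃ z' : W.Unstable P, z'.pt = z := by
  obtain ⟨p, hp, hx⟩ := x.unstable
  refine ⟨⟨z, p, hp, UnstableEquiv.trans ?_ hx⟩, rfl⟩
  exact unstableEquiv_of_forall_dist_le fun n => by rw [dist_comm]; exact h n

/-- The strict inequality for each coordinate in the definition of `X^u(x, δ)` is uniform over the
coordinates, because of the contraction; hence these sets are open for the uniform structure. -/
theorem exists_ball_subset {x y : W.Unstable P} {δ : ℝ} (hδ : δ ≤ W.β) (h : y ∈ x.ball δ) :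
    ∃ η, 0 < η ∧ y.ball η ⊆ x.ball δ := by
  have hd := forall_dist_le_of_mem_ball hδ h
  -- The largest of the first `K` distances bounds all distances.
  obtain ⟨i, hi, hmax⟩ := Finset.exists_max_image (Finset.range W.K)
    (fun n => dist (x.pt.1 n) (y.pt.1 n)) ⟨0, Finset.mem_range.mpr W.K_pos⟩
  have hall : ∀ n, dist (x.pt.1 n) (y.pt.1 n) ≤ dist (x.pt.1 i) (y.pt.1 i) := by
    intro n
    induction n using Nat.strong_induction_on with
    | _ n ih =>
      rcases lt_or_ge n W.K with hn | hn
      · exact hmax n (Finset.mem_range.mpr hn)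
      · have := dist_add_K_le hd (n - W.K)
        rw [Nat.sub_add_cancel hn] at this
        refine this.trans ((mul_le_of_le_one_left dist_nonneg W.γ_pow_K_lt_one.le).trans ?_)
        exact ih _ (Nat.sub_lt_of_pos_le W.K_pos hn)
  refine ⟨min (δ - dist (x.pt.1 i) (y.pt.1 i)) (δ - W.dX x.pt y.pt),
    lt_min (sub_pos.mpr (h.1 i)) (sub_pos.mpr h.2), fun z hz => ⟨fun n => ?_, ?_⟩⟩
  · have h1 := (hz.1 n).trans_le (min_le_left _ _)
    have h2 := hall n
    have h3 := dist_triangle (x.pt.1 n) (y.pt.1 n) (z.pt.1 n)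
    linarith
  · have h1 := hz.2.trans_le (min_le_right _ _)
    have h3 := W.dX_triangle x.pt y.pt z.pt
    linarith

theorem isOpen_ball (x : W.Unstable P) {δ : ℝ} (h : δ ≤ W.β / 2) : IsOpen (x.ball δ) := by
  rcases lt_or_ge 0 δ with h0 | h0
  · exact TopologicalSpace.isOpen_generateFrom_of_mem ⟨x, δ, h0, h, rfl⟩
  · convert isOpen_empty
    ext y
    simp only [mem_empty_iff_false, iff_false]
    exact fun hy => absurd (hy.1 0) (not_lt.mpr (h0.trans dist_nonneg))

theorem ball_mem_nhds (x : W.Unstable P) {δ : ℝ} (hδ : 0 < δ) : x.ball δ ∈ 𝓝 x := by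
  have hβ := W.β_pos
  refine mem_of_superset ((x.isOpen_ball (min_le_right δ (W.β / 2))).mem_nhds
    (x.mem_ball_self (by positivity))) (x.ball_mono (min_le_left _ _))

theorem mem_nhds_iff {x : W.Unstable P} {s : Set (W.Unstable P)} :
    s ∈ 𝓝 x ↔ ∃ δ, 0 < δ ∧ x.ball δ ⊆ s := by
  refine ⟨fun h => ?_, fun ⟨δ, hδ, h⟩ => mem_of_superset (x.ball_mem_nhds hδ) h⟩
  obtain ⟨U, hUs, hU, hx⟩ := _root_.mem_nhds_iff.mp h
  suffices ∃ δ, 0 < δ ∧ x.ball δ ⊆ U from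
    let ⟨δ, hδ, h⟩ := this
    ⟨δ, hδ, h.trans hUs⟩
  clear h hUs s
  induction hU with
  | basic U hU =>
    obtain ⟨y, δ, -, hδ, rfl⟩ := hU
    exact exists_ball_subset (by linarith [W.β_pos]) hx
  | univ => exact ⟨1, one_pos, subset_univ _⟩
  | inter s t _ _ hs ht =>
    obtain ⟨a, ha, h⟩ := hs hx.1
    obtain ⟨b, hb, h'⟩ := ht hx.2
    exact ⟨min a b, lt_min ha hb, subset_inter ((x.ball_mono (min_le_left _ _)).trans h)
      ((x.ball_mono (min_le_right _ _)).trans h')⟩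
  | sUnion S _ ih =>
    obtain ⟨U, hU, hxU⟩ := hx
    obtain ⟨δ, hδ, h⟩ := ih U hU hxU
    exact ⟨δ, hδ, h.trans (subset_sUnion_of_mem hU)⟩

theorem continuous_coord (n : ℕ) : Continuous fun x : W.Unstable P => x.pt.1 n := by
  refine continuous_iff_continuousAt.mpr fun x => Metric.tendsto_nhds.mpr fun η hη => ?_
  filter_upwards [x.ball_mem_nhds hη] with y hy
  rw [dist_comm]
  exact hy.1 n

theorem continuous_π₀ : Continuous (π₀ : W.Unstable P → Y) := continuous_coord 0

theorem π₀_injOn_ball (x : W.Unstable P) {δ : ℝ} (hδ : δ ≤ W.β / 2) : InjOn π₀ (x.ball δ) := by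
  intro y hy z hz h
  refine Unstable.ext (Subtype.ext (funext fun n => dist_le_zero.mp (le_of_forall_pos_le_add
    fun η hη => ?_)))
  obtain ⟨κ, hκ, H⟩ := W.exists_mem_localUnstable_of_dist_zero_lt hη
  have h0 : dist (y.pt.1 0) (z.pt.1 0) = 0 := dist_eq_zero.mpr h
  rw [zero_add]
  exact ((H y.pt z.pt (forall_dist_le_of_mem_ball_of_mem_ball hδ hy hz) (h0 ▸ hκ)).1 n).le

/-- On an open subset of a local unstable set `π₀` is an embedding, so that the filter of images of
the neighbourhoods of a point is the trace of the neighbourhood filter of `Y` on the image. -/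
theorem map_π₀_nhds {x : W.Unstable P} {δ : ℝ} (hδ : δ ≤ W.β / 2) {U : Set (W.Unstable P)}
    (hU : IsOpen U) (hUx : U ⊆ x.ball δ) {y : W.Unstable P} (hy : y ∈ U) :
    Filter.map π₀ (𝓝 y) = 𝓝[π₀ '' U] y.π₀ := by
  have h : 𝓝 y = 𝓟 U ⊓ comap π₀ (𝓝 y.π₀) := by
    refine le_antisymm (le_inf (le_principal_iff.mpr (hU.mem_nhds hy))
      continuous_π₀.continuousAt.le_comap) fun s hs => ?_
    obtain ⟨η, hη, hs⟩ := mem_nhds_iff.mp hs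
    obtain ⟨κ, hκ, H⟩ := W.exists_mem_localUnstable_of_dist_zero_lt hη
    refine mem_of_superset (inter_mem_inf (mem_principal_self U)
      (preimage_mem_comap (Metric.ball_mem_nhds _ hκ))) fun z hz => hs ?_
    refine H y.pt z.pt (forall_dist_le_of_mem_ball_of_mem_ball hδ (hUx hy) (hUx hz.1)) ?_
    rw [dist_comm]
    exact hz.2
  rw [h, Filter.push_pull, map_principal, inf_comm]
  rfl

theorem map_π₀_nhds_ball {x y : W.Unstable P} {δ : ℝ} (hδ : δ ≤ W.β / 2) (hy : y ∈ x.ball δ) :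
    Filter.map π₀ (𝓝 y) = 𝓝[π₀ '' x.ball δ] y.π₀ :=
  map_π₀_nhds hδ (x.isOpen_ball hδ) Subset.rfl hy

theorem exists_lift {η : ℝ} (hη : 0 < η) :
    ∃ δ, 0 < δ ∧ ∀ (x : W.Unstable P) (v : Y), dist v (x.pt.1 W.K) < δ →
      ∃ z ∈ x.ball η, z.π₀ = W.g^[W.K] v := by
  obtain ⟨δ, hδ, H⟩ := W.exists_lift (lt_min hη W.β_pos)
  refine ⟨δ, hδ, fun x v hv => ?_⟩
  obtain ⟨z, hz, h0⟩ := H x.pt v hv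
  obtain ⟨z, rfl⟩ := x.exists_of_forall_dist_le fun n => ((hz.1 n).trans_le (min_le_right _ _)).le
  exact ⟨z, x.ball_mono (min_le_left _ _) hz, h0⟩

/-- The images under `π₀` of the neighbourhoods of `x` depend on the coordinate `x_K` alone. -/
theorem map_π₀_nhds_eq_map_iterate (x : W.Unstable P) :
    Filter.map π₀ (𝓝 x) = Filter.map W.g^[W.K] (𝓝 (x.pt.1 W.K)) := by
  refine le_antisymm ?_ fun s hs => ?_
  · have : (π₀ : W.Unstable P → Y) = W.g^[W.K] ∘ fun x => x.pt.1 W.K := by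
      funext y
      have := W.iterate_coord y.pt W.K 0
      rw [Nat.zero_add] at this
      exact this.symm
    rw [this, ← map_map]
    exact map_mono (continuous_coord W.K).continuousAt
  · obtain ⟨η, hη, hs⟩ := mem_nhds_iff.mp hs
    obtain ⟨δ, hδ, H⟩ := exists_lift (P := P) hη
    refine mem_map.mpr (mem_of_superset (Metric.ball_mem_nhds _ hδ) fun v hv => ?_)
    obtain ⟨z, hz, h0⟩ := H x v hv
    have : z.π₀ ∈ s := hs hz
    rwa [h0] at this

theorem isCompact_setOf_forall_dist_le (x : W.Unstable P) :
    IsCompact {y : W.Unstable P | ∀ n, dist (x.pt.1 n) (y.pt.1 n) ≤ W.β / 2} := by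
  have hβ := W.β_pos
  refine isCompact_iff_ultrafilter_le_nhds.mpr fun f hf => ?_
  have hmem := le_principal_iff.mp hf
  have hcl : IsClosed {z : ℕ → Y | (∀ i, W.g (z (i + 1)) = z i) ∧
      ∀ n, dist (x.pt.1 n) (z n) ≤ W.β / 2} := by
    simp only [ofPred_and, ofPred_forall]
    refine IsClosed.inter (isClosed_iInter fun i => ?_) (isClosed_iInter fun n => ?_)
    · exact isClosed_eq (W.continuous_g.comp (continuous_apply _)) (continuous_apply _)
    · exact isClosed_le (continuous_const.dist (continuous_apply n)) continuous_const
  obtain ⟨z, hz, hfz⟩ := isCompact_iff_ultrafilter_le_nhds.mp hcl.isCompact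
    (f.map fun y : W.Unstable P => y.pt.1) (by
      rw [le_principal_iff]
      exact mem_map.mpr (mem_of_superset hmem fun y hy => ⟨y.pt.2, hy⟩))
  obtain ⟨z', hz'⟩ := x.exists_of_forall_dist_le (z := ⟨z, hz.1⟩)
    fun n => (hz.2 n).trans (by linarith)
  obtain rfl : z'.pt.1 = z := congrArg Subtype.val hz'
  refine ⟨z', hz.2, fun s hs => ?_⟩
  obtain ⟨η, hη, hs⟩ := mem_nhds_iff.mp hs
  obtain ⟨κ, hκ, H⟩ := W.exists_mem_localUnstable_of_dist_zero_lt hη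
  have h0 : Tendsto (fun y : W.Unstable P => y.pt.1 0) f (𝓝 (z'.pt.1 0)) :=
    (continuous_apply 0).continuousAt.tendsto.comp hfz
  filter_upwards [hmem, h0 (Metric.ball_mem_nhds _ hκ)] with y hy hy0
  refine hs (H z'.pt y.pt (fun n => ?_) (by rw [dist_comm]; exact hy0))
  have h1 := hy n
  have h2 := hz.2 n
  have h3 := dist_triangle_left (z'.pt.1 n) (y.pt.1 n) (x.pt.1 n)
  linarith

/-! ### The homeomorphism induced by `φ` -/

theorem exists_map_mem_ball (hP : W.φ '' P = P) {η : ℝ} (hη : 0 < η) :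
    ∃ δ, 0 < δ ∧ ∀ x y : W.Unstable P, y ∈ x.ball δ → y.map hP ∈ (x.map hP).ball η := by
  obtain ⟨δ₁, h₁, H₁⟩ := W.exists_mem_localUnstable_of_forall_dist_lt hη
  obtain ⟨δ₂, h₂, H₂⟩ := W.exists_modulus_iterate 1 h₁
  exact ⟨δ₂, h₂, fun x y h => H₁ _ _ fun n => H₂ 1 le_rfl _ _ (h.1 n)⟩

/-- The homeomorphism of `X^u(P)` induced by `φ`. -/
def mapHomeomorph (hP : W.φ '' P = P) : W.Unstable P ≃ₜ W.Unstable P where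
  toFun := Unstable.map hP
  invFun x :=
    { pt := W.φ.symm x.pt
      unstable := by
        obtain ⟨p, hp, h⟩ := x.unstable
        rw [← hP] at hp
        obtain ⟨p, hp, rfl⟩ := hp
        exact ⟨p, hp, by simpa using h.map_symm⟩ }
  left_inv x := Unstable.ext (W.φ.symm_apply_apply _)
  right_inv x := Unstable.ext (W.φ.apply_symm_apply _)
  continuous_toFun := continuous_iff_continuousAt.mpr fun x s hs => by
    obtain ⟨η, hη, hs⟩ := mem_nhds_iff.mp hs
    obtain ⟨δ, hδ, H⟩ := exists_map_mem_ball hP hη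
    exact mem_map.mpr (mem_of_superset (x.ball_mem_nhds hδ) fun y hy => hs (H x y hy))
  continuous_invFun := continuous_iff_continuousAt.mpr fun x s hs => by
    obtain ⟨η, hη, hs⟩ := mem_nhds_iff.mp hs
    obtain ⟨δ, hδ, H⟩ := W.exists_mem_localUnstable_of_forall_dist_lt hη
    exact mem_map.mpr (mem_of_superset (x.ball_mem_nhds hδ)
      fun y hy => hs (H _ _ fun n => hy.1 (n + 1)))

theorem map_iterate_pt (hP : W.φ '' P = P) (x : W.Unstable P) (n : ℕ) :
    ((Unstable.map hP)^[n] x).pt = W.φ^[n] x.pt := by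
  induction n with
  | zero => rfl
  | succ n ih =>
    rw [Function.iterate_succ_apply', Function.iterate_succ_apply', ← ih]
    rfl

theorem map_π₀_nhds_map (hP : W.φ '' P = P) (x : W.Unstable P) :
    Filter.map π₀ (𝓝 (x.map hP)) = Filter.map W.g (Filter.map π₀ (𝓝 x)) := by
  have h := (mapHomeomorph hP).map_nhds_eq x
  change Filter.map (Unstable.map hP) (𝓝 x) = 𝓝 (x.map hP) at h
  rw [← h, Filter.map_map, Filter.map_map]
  rfl

end Unstable

/-! ### The relation `∼₀` -/

variable {ε : ℝ}

theorem Rel₀_iff (hε : 0 < ε) (hεβ : ε ≤ W.β / 2) {x y : W.Unstable P} :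
    W.Rel₀ P ε x y ↔ Filter.map Unstable.π₀ (𝓝 x) = Filter.map Unstable.π₀ (𝓝 y) := by
  constructor
  · rintro ⟨hxy, δ, hδ, hδε, U, hU, hUy, heq⟩
    have hx : x ∈ x.ball δ := x.mem_ball_self hδ
    have hyU : y ∈ U := by
      obtain ⟨u, hu, hux⟩ := heq ▸ mem_image_of_mem Unstable.π₀ hx
      rwa [← y.π₀_injOn_ball hεβ (hUy hu) (y.mem_ball_self hε) (hux.trans hxy)]
    rw [Unstable.map_π₀_nhds_ball (hδε.le.trans hεβ) hx, Unstable.map_π₀_nhds hεβ hU hUy hyU,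
      heq, hxy]
  · intro h
    have hxy : x.π₀ = y.π₀ := by
      by_contra hne
      have hd := disjoint_nhds_nhds.mpr hne
      have hbot := hd.mono (Unstable.continuous_π₀ (W := W) (P := P)).continuousAt
        (h.le.trans (Unstable.continuous_π₀ (W := W) (P := P)).continuousAt)
      rw [disjoint_self, Filter.map_eq_bot_iff] at hbot
      exact NeBot.ne inferInstance hbot
    have hx := Unstable.map_π₀_nhds_ball (by linarith : ε / 2 ≤ W.β / 2)
      (x.mem_ball_self (half_pos hε))
    have hy := Unstable.map_π₀_nhds_ball hεβ (y.mem_ball_self hε)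
    have hev := nhdsWithin_eq_iff_eventuallyEq.mp (hxy ▸ hx.symm.trans (h.trans (hxy ▸ hy)))
    -- `G` is a neighbourhood of `x₀` in which the images of the two local unstable sets coincide.
    obtain ⟨G, hG, hGo, hxG⟩ := eventually_nhds_iff.mp hev
    obtain ⟨δ, hδ, hδG⟩ := Unstable.mem_nhds_iff.mp
      ((hGo.preimage Unstable.continuous_π₀).mem_nhds
        (show x ∈ Unstable.π₀ ⁻¹' G by rwa [mem_preimage, hxy]))
    set δ' := min δ (ε / 2)
    have hδ' : 0 < δ' := lt_min hδ (half_pos hε)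
    have hδε : δ' ≤ ε / 2 := min_le_right _ _
    have hsub : ∀ w ∈ x.ball δ', w.π₀ ∈ G ∧ w.π₀ ∈ Unstable.π₀ '' y.ball ε := fun w hw => by
      have hwG : w.π₀ ∈ G := hδG (x.ball_mono (min_le_left _ _) hw)
      exact ⟨hwG, (hG _ hwG).mp ⟨w, x.ball_mono hδε hw, rfl⟩⟩
    refine ⟨hxy, δ', hδ', by linarith, y.ball ε ∩ Unstable.π₀ ⁻¹' (Unstable.π₀ '' x.ball δ'),
      ?_, inter_subset_left, ?_⟩
    · rw [isOpen_iff_mem_nhds]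
      rintro z ⟨hz, w, hw, hwz⟩
      refine inter_mem ((y.isOpen_ball hεβ).mem_nhds hz) ?_
      rw [← mem_map, Unstable.map_π₀_nhds_ball hεβ hz, ← hwz,
        ← nhdsWithin_eq_iff_eventuallyEq.mpr (eventually_of_mem (hGo.mem_nhds (hsub w hw).1) hG),
        ← Unstable.map_π₀_nhds_ball (by linarith) (x.ball_mono hδε hw)]
      exact image_mem_map ((x.isOpen_ball (by linarith)).mem_nhds hw)
    · rw [image_inter_preimage, inter_eq_right.mpr]
      rintro _ ⟨w, hw, rfl⟩
      exact (hsub w hw).2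

theorem Rel₀_equivalence (hε : 0 < ε) (hεβ : ε ≤ W.β / 2) : Equivalence (W.Rel₀ P ε) where
  refl _ := (Rel₀_iff hε hεβ).mpr rfl
  symm h := (Rel₀_iff hε hεβ).mpr ((Rel₀_iff hε hεβ).mp h).symm
  trans h h' := (Rel₀_iff hε hεβ).mpr
    (((Rel₀_iff hε hεβ).mp h).trans ((Rel₀_iff hε hεβ).mp h'))

/-! ### The quotient space -/

variable (W P ε) in
/-- The quotient map `X^u(P) → X^u(P)/∼₀`. -/
def toQuotient₀ : W.Unstable P → W.Quotient₀ P ε := Quot.mk _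

theorem continuous_toQuotient₀ : Continuous (W.toQuotient₀ P ε) := continuous_quot_mk

theorem surjective_toQuotient₀ : Function.Surjective (W.toQuotient₀ P ε) := Quot.mk_surjective

theorem continuous_r : Continuous (W.r P ε) := 
  continuous_quot_lift _ Unstable.continuous_π₀

theorem toQuotient₀_eq_iff (hε : 0 < ε) (hεβ : ε ≤ W.β / 2) {x y : W.Unstable P} :
    W.toQuotient₀ P ε x = W.toQuotient₀ P ε y ↔
      Filter.map Unstable.π₀ (𝓝 x) = Filter.map Unstable.π₀ (𝓝 y) :=
  ((Rel₀_equivalence hε hεβ).quot_mk_eq_iff x y).trans (Rel₀_iff hε hεβ)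

/-- Two subsets of `Y` with the same germ at a point have the same germ at all nearby points, so
`∼₀` identifies neighbourhoods of equivalent points. -/
theorem isOpenMap_toQuotient₀ (hε : 0 < ε) (hεβ : ε ≤ W.β / 2) :
    IsOpenMap (W.toQuotient₀ P ε) := by
  intro O hO
  change IsOpen (W.toQuotient₀ P ε ⁻¹' (W.toQuotient₀ P ε '' O))
  rw [isOpen_iff_mem_nhds]
  rintro y ⟨x, hx, hxy⟩
  have hr : x.π₀ = y.π₀ := congrArg (W.r P ε) hxy
  have h := (toQuotient₀_eq_iff hε hεβ).mp hxy
  have hU : IsOpen (O ∩ x.ball ε) := hO.inter (x.isOpen_ball hεβ)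
  have hxU : x ∈ O ∩ x.ball ε := ⟨hx, x.mem_ball_self hε⟩
  have hy := y.mem_ball_self hε
  rw [Unstable.map_π₀_nhds hεβ hU inter_subset_right hxU,
    Unstable.map_π₀_nhds_ball hεβ hy, hr, nhdsWithin_eq_iff_eventuallyEq] at h
  filter_upwards [(y.isOpen_ball hεβ).mem_nhds hy,
    Unstable.continuous_π₀.continuousAt.eventually (eventually_eventually_nhds.mpr h)] with z hz hev
  obtain ⟨w, hw, hwz⟩ := hev.self_of_nhds.mpr ⟨z, hz, rfl⟩
  refine ⟨w, hw.1, (toQuotient₀_eq_iff hε hεβ).mpr ?_⟩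
  rw [Unstable.map_π₀_nhds hεβ hU inter_subset_right hw, Unstable.map_π₀_nhds_ball hεβ hz, hwz]
  exact nhdsWithin_eq_iff_eventuallyEq.mpr hev

theorem toQuotient₀_eq_of_coord_K (hε : 0 < ε) (hεβ : ε ≤ W.β / 2) {x y : W.Unstable P}
    (h : x.pt.1 W.K = y.pt.1 W.K) : W.toQuotient₀ P ε x = W.toQuotient₀ P ε y := by
  rw [toQuotient₀_eq_iff hε hεβ, Unstable.map_π₀_nhds_eq_map_iterate,
    Unstable.map_π₀_nhds_eq_map_iterate, h]

theorem r_injOn_image_ball {δ : ℝ} (hδ : δ ≤ W.β / 2) (x : W.Unstable P) :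
    InjOn (W.r P ε) (W.toQuotient₀ P ε '' x.ball δ) := by
  rintro _ ⟨y, hy, rfl⟩ _ ⟨z, hz, rfl⟩ h
  rw [x.π₀_injOn_ball hδ hy hz h]

theorem locallyHausdorff_quotient₀ (hε : 0 < ε) (hεβ : ε ≤ W.β / 2) :
    LocallyHausdorff (W.Quotient₀ P ε) := by
  intro a
  obtain ⟨x, rfl⟩ := surjective_toQuotient₀ a
  refine ⟨_, isOpenMap_toQuotient₀ hε hεβ _ (x.isOpen_ball hεβ),
    mem_image_of_mem _ (x.mem_ball_self hε), ?_⟩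
  exact T2Space.of_injective_continuous (r_injOn_image_ball hεβ x).injective
    (continuous_r.comp continuous_subtype_val)

/-- `∼₀`-classes are determined by the `K`-th coordinate, and up to `φ^K` this coordinate is the
zeroth one; so finitely many compact sets `φ^K (closed local unstable set)` meet every class. -/
theorem compactSpace_quotient₀ (hP : W.φ '' P = P) (hε : 0 < ε) (hεβ : ε ≤ W.β / 2) :
    CompactSpace (W.Quotient₀ P ε) := by
  obtain ⟨δ, hδ, H⟩ := Unstable.exists_lift (W := W) (P := P) (half_pos W.β_pos)
  obtain ⟨t, hts, ht, hcov⟩ := Metric.finite_approx_of_totallyBounded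
    (isCompact_univ.totallyBounded.subset (subset_univ
      (range fun x : W.Unstable P => x.pt.1 W.K))) δ hδ
  have := ht.to_subtype
  choose s hs using fun y : t => hts y.2
  let f : W.Unstable P → W.Quotient₀ P ε := W.toQuotient₀ P ε ∘ (Unstable.map hP)^[W.K]
  have hf : Continuous f :=
    continuous_toQuotient₀.comp ((Unstable.mapHomeomorph hP).continuous.iterate _)
  have hc : IsCompact (⋃ y : t,
      f '' {z | ∀ n, dist ((s y).pt.1 n) (z.pt.1 n) ≤ W.β / 2}) :=
    isCompact_iUnion fun y => (s y).isCompact_setOf_forall_dist_le.image hf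
  refine ⟨hc.of_isClosed_subset isClosed_univ fun a _ => ?_⟩
  obtain ⟨w, rfl⟩ := surjective_toQuotient₀ a
  obtain ⟨x, rfl⟩ := (Unstable.mapHomeomorph hP).surjective.iterate W.K w
  obtain ⟨y, hy, hxy⟩ := mem_iUnion₂.mp (hcov (mem_range_self x))
  obtain ⟨z, hz, hzx⟩ := H (s ⟨y, hy⟩) (x.pt.1 W.K) (by
    rw [show (s ⟨y, hy⟩).pt.1 W.K = y from hs ⟨y, hy⟩]
    exact hxy)
  refine mem_iUnion.mpr ⟨⟨y, hy⟩, z, fun n => (hz.1 n).le, toQuotient₀_eq_of_coord_K hε hεβ ?_⟩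
  change ((Unstable.map hP)^[W.K] z).pt.1 W.K = ((Unstable.map hP)^[W.K] x).pt.1 W.K
  rw [Unstable.map_iterate_pt, Unstable.map_iterate_pt, φ_iterate_coord_of_le W _ le_rfl,
    Nat.sub_self, φ_iterate_coord, ← hzx]
  rfl

/-- Irreducibility makes `X^u(P)` dense in the solenoid, and then axiom two lets its `π₀`-image
absorb every point of `Y`. -/
theorem surjective_r (hP : W.φ '' P = P) (hirr : W.Irreducible) (hne : P.Nonempty) :
    Function.Surjective (W.r P ε) := by
  intro y
  obtain ⟨p, hp⟩ := hne
  obtain ⟨v, rfl⟩ := W.exists_solenoid_coord_zero y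
  let p' : W.Unstable P := ⟨p, p, hp, unstableEquiv_of_forall_dist_le fun n => by
    simpa using W.β_pos.le⟩
  obtain ⟨δ, hδ, H⟩ := Unstable.exists_lift (W := W) (P := P) one_pos
  have hopen : ∀ (w : W.Solenoid) (k : ℕ),
      IsOpen {u : W.Solenoid | dist (u.1 k) (w.1 W.K) < δ} := fun w k =>
    isOpen_lt (((continuous_apply k).comp continuous_subtype_val).dist continuous_const)
      continuous_const
  obtain ⟨n, -, _, ⟨u, hu, rfl⟩, hn⟩ := hirr _ _ (hopen p W.K)
    ⟨p, by simpa using hδ⟩ (hopen v 0) ⟨W.φ.symm^[W.K] v, by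
      rw [mem_ofPred_eq, φ_symm_iterate_coord]
      simpa using hδ⟩
  obtain ⟨w, -, hw⟩ := H p' (u.1 W.K) hu
  have huK := W.iterate_coord u W.K 0
  rw [Nat.zero_add] at huK
  -- At the coordinate `K` the point `φ^(n+K) w` shows only `w₀ = u₀`, as `φ^(n+K) u` does.
  obtain ⟨z, -, hz⟩ := H ((Unstable.map hP)^[n + W.K] w) (v.1 W.K) (by
    rw [Unstable.map_iterate_pt, Function.iterate_add_apply, φ_iterate_coord,
      φ_iterate_coord_of_le W _ le_rfl, Nat.sub_self, dist_comm,
      show w.pt.1 0 = u.1 0 from hw.trans huK, ← φ_iterate_coord]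
    exact hn)
  have hvK := W.iterate_coord v W.K 0
  rw [Nat.zero_add] at hvK
  exact ⟨W.toQuotient₀ P ε z, hz.trans hvK⟩

/-- The map induced by `φ` on `X^u(P)/∼₀`. -/
def quotientMap (hP : W.φ '' P = P) (hε : 0 < ε) (hεβ : ε ≤ W.β / 2) :
    W.Quotient₀ P ε → W.Quotient₀ P ε :=
  Quot.map (Unstable.map hP) fun x y h => by
    rw [Rel₀_iff hε hεβ] at h ⊢
    rw [Unstable.map_π₀_nhds_map, Unstable.map_π₀_nhds_map, h]

section

variable (hP : W.φ '' P = P) (hε : 0 < ε) (hεβ : ε ≤ W.β / 2)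

theorem quotientMap_toQuotient₀ (x : W.Unstable P) :
    quotientMap hP hε hεβ (W.toQuotient₀ P ε x) = W.toQuotient₀ P ε (x.map hP) := rfl

theorem quotientMap_iterate_toQuotient₀ (n : ℕ) (x : W.Unstable P) :
    (quotientMap hP hε hεβ)^[n] (W.toQuotient₀ P ε x) =
      W.toQuotient₀ P ε ((Unstable.map hP)^[n] x) := by
  induction n with
  | zero => rfl
  | succ n ih =>
    rw [Function.iterate_succ_apply', Function.iterate_succ_apply', ih, quotientMap_toQuotient₀]

theorem r_quotientMap (a : W.Quotient₀ P ε) :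
    W.r P ε (quotientMap hP hε hεβ a) = W.g (W.r P ε a) := by
  obtain ⟨x, rfl⟩ := surjective_toQuotient₀ a
  rfl

theorem r_quotientMap_iterate (n : ℕ) (a : W.Quotient₀ P ε) :
    W.r P ε ((quotientMap hP hε hεβ)^[n] a) = W.g^[n] (W.r P ε a) := by
  induction n with
  | zero => rfl
  | succ n ih => rw [Function.iterate_succ_apply', Function.iterate_succ_apply', r_quotientMap, ih]

theorem surjective_quotientMap : Function.Surjective (quotientMap hP hε hεβ) := by
  intro a
  obtain ⟨x, rfl⟩ := surjective_toQuotient₀ a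
  obtain ⟨y, rfl⟩ := (Unstable.mapHomeomorph hP).surjective x
  exact ⟨W.toQuotient₀ P ε y, rfl⟩

theorem continuous_quotientMap : Continuous (quotientMap hP hε hεβ) :=
  continuous_quot_lift _ (continuous_quot_mk.comp (Unstable.mapHomeomorph hP).continuous)

theorem isOpenMap_quotientMap : IsOpenMap (quotientMap hP hε hεβ) := by
  intro O hO
  have h : quotientMap hP hε hεβ '' O =
      W.toQuotient₀ P ε '' (Unstable.mapHomeomorph hP '' (W.toQuotient₀ P ε ⁻¹' O)) := by
    conv_lhs => rw [← image_preimage_eq O (surjective_toQuotient₀ (W := W) (P := P) (ε := ε))]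
    rw [image_image, image_image]
    rfl
  rw [h]
  exact isOpenMap_toQuotient₀ hε hεβ _
    ((Unstable.mapHomeomorph hP).isOpenMap _ (hO.preimage continuous_toQuotient₀))

/-- The map `g̃` identifies no two points which share a sufficiently small local unstable set. -/
theorem exists_quotientMap_injOn : ∃ δ, 0 < δ ∧ δ ≤ W.β / 2 ∧ ∀ x : W.Unstable P,
    InjOn (quotientMap hP hε hεβ) (W.toQuotient₀ P ε '' x.ball δ) := by
  have hβ := W.β_pos
  obtain ⟨δ, hδ, H⟩ := Unstable.exists_map_mem_ball hP (half_pos hβ)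
  refine ⟨min δ (W.β / 2), lt_min hδ (half_pos hβ), min_le_right _ _, fun x => ?_⟩
  rintro _ ⟨y, hy, rfl⟩ _ ⟨z, hz, rfl⟩ h
  have hr : (y.map hP).π₀ = (z.map hP).π₀ := congrArg (W.r P ε) h
  have hyz := (x.map hP).π₀_injOn_ball le_rfl (H x y (x.ball_mono (min_le_left _ _) hy))
    (H x z (x.ball_mono (min_le_left _ _) hz)) hr
  rw [(Unstable.mapHomeomorph hP).injective hyz]

theorem isLocalHomeomorph_quotientMap : IsLocalHomeomorph (quotientMap hP hε hεβ) := by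
  obtain ⟨δ, hδ, hδβ, H⟩ := exists_quotientMap_injOn hP hε hεβ
  refine isLocalHomeomorph_iff_isOpenEmbedding_restrict.mpr fun a => ?_
  obtain ⟨x, rfl⟩ := surjective_toQuotient₀ a
  have hU := isOpenMap_toQuotient₀ hε hεβ _ (x.isOpen_ball hδβ)
  refine ⟨_, hU.mem_nhds (mem_image_of_mem _ (x.mem_ball_self hδ)), ?_⟩
  exact .of_continuous_injective_isOpenMap
    ((continuous_quotientMap hP hε hεβ).comp continuous_subtype_val) (H x).injective
    ((isOpenMap_quotientMap hP hε hεβ).domRestrict hU)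

theorem quotientMap_iterate_K_eq {a b : W.Quotient₀ P ε} (h : W.r P ε a = W.r P ε b) :
    (quotientMap hP hε hεβ)^[W.K] a = (quotientMap hP hε hεβ)^[W.K] b := by
  obtain ⟨x, rfl⟩ := surjective_toQuotient₀ a
  obtain ⟨y, rfl⟩ := surjective_toQuotient₀ b
  rw [quotientMap_iterate_toQuotient₀, quotientMap_iterate_toQuotient₀]
  refine toQuotient₀_eq_of_coord_K hε hεβ ?_
  rw [Unstable.map_iterate_pt, Unstable.map_iterate_pt, φ_iterate_coord_of_le W _ le_rfl,
    φ_iterate_coord_of_le W _ le_rfl, Nat.sub_self]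
  exact h

/-- Orbits that stay together in the cover by small local unstable sets have close orbits in `Y`,
which by Wieler's first axiom agree from time `K` on; then `r` separates points within a member of
the cover, and injectivity of `g̃` on the members allows a descent to time `0`. -/
theorem forwardOrbitExpansive_quotientMap : ForwardOrbitExpansive (quotientMap hP hε hεβ) := by
  obtain ⟨δ, hδ, hδβ, H⟩ := exists_quotientMap_injOn hP hε hεβ
  have := compactSpace_quotient₀ hP hε hεβ
  let s := Function.surjInv (surjective_toQuotient₀ (W := W) (P := P) (ε := ε))
  let U : W.Quotient₀ P ε → Set (W.Quotient₀ P ε) := fun a => W.toQuotient₀ P ε '' (s a).ball δ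
  have hU : ∀ a, IsOpen (U a) := fun a =>
    isOpenMap_toQuotient₀ hε hεβ _ ((s a).isOpen_ball hδβ)
  obtain ⟨t, -, ht⟩ := isCompact_univ.elim_nhds_subcover U fun a _ => (hU a).mem_nhds
    ⟨s a, (s a).mem_ball_self hδ, Function.surjInv_eq _ a⟩
  set f := quotientMap hP hε hεβ with hf
  refine ⟨t.card, fun i => U (t.equivFin.symm i), fun i => hU _, ?_, fun a b hab => ?_⟩
  · refine eq_univ_of_univ_subset (ht.trans (iUnion₂_subset fun a ha => ?_))
    refine subset_iUnion_of_subset (t.equivFin ⟨a, ha⟩) ?_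
    rw [Equiv.symm_apply_apply]
  replace hab : ∀ n, ∃ c, f^[n] a ∈ U c ∧ f^[n] b ∈ U c := fun n =>
    let ⟨i, hi⟩ := hab n
    ⟨_, hi⟩
  have hdist : ∀ n, dist (W.g^[n] (W.r P ε a)) (W.g^[n] (W.r P ε b)) ≤ W.β := by
    intro n
    rw [← r_quotientMap_iterate hP hε hεβ, ← r_quotientMap_iterate hP hε hεβ, ← hf]
    obtain ⟨c, ⟨y, hy, hya⟩, z, hz, hzb⟩ := hab n
    rw [← hya, ← hzb]
    exact Unstable.forall_dist_le_of_mem_ball_of_mem_ball hδβ hy hz 0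
  have hcontr : ∀ j n, dist (W.g^[n + W.K] (W.r P ε a)) (W.g^[n + W.K] (W.r P ε b)) ≤
      (W.γ ^ W.K) ^ j * W.β := by
    intro j
    induction j with
    | zero => intro n; simpa using hdist (n + W.K)
    | succ j ih =>
      intro n
      have h1 := W.axiom_one _ _ (hdist n)
      have h2 := ih (n + W.K)
      rw [← Function.iterate_add_apply, ← Function.iterate_add_apply,
        ← Function.iterate_add_apply, ← Function.iterate_add_apply, Nat.add_comm W.K n,
        show 2 * W.K + n = n + W.K + W.K by ring] at h1
      rw [pow_succ', mul_assoc]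
      exact h1.trans (mul_le_mul_of_nonneg_left h2 (pow_nonneg W.γ_pos.le _))
  have hK : W.r P ε (f^[W.K] a) = W.r P ε (f^[W.K] b) := by
    rw [hf, r_quotientMap_iterate, r_quotientMap_iterate]
    have hlim : Tendsto (fun j : ℕ => (W.γ ^ W.K) ^ j * W.β) atTop (𝓝 0) := by
      simpa using (tendsto_pow_atTop_nhds_zero_of_lt_one (pow_nonneg W.γ_pos.le _)
        W.γ_pow_K_lt_one).mul_const W.β
    refine dist_le_zero.mp (ge_of_tendsto' hlim fun j => ?_)
    simpa using hcontr j 0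
  have hdesc : ∀ n, f^[n] a = f^[n] b → a = b := by
    intro n
    induction n with
    | zero => exact id
    | succ n ih =>
      intro h
      obtain ⟨c, hca, hcb⟩ := hab n
      rw [Function.iterate_succ_apply', Function.iterate_succ_apply'] at h
      exact ih (H _ hca hcb h)
  obtain ⟨c, hca, hcb⟩ := hab W.K
  exact hdesc W.K (r_injOn_image_ball hδβ _ hca hcb hK)

/-- Fibres of any map `q` at least as fine as `r` collapse to a point under `g̃^K`. -/
theorem exists_image_iterate_eq_singleton {Z : Type*} (q : W.Quotient₀ P ε → Z)
    (hq : ∀ a b, q a = q b → W.r P ε a = W.r P ε b) {y : Z} (hy : y ∈ range q) :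
    ∃ z, (quotientMap hP hε hεβ)^[W.K] '' (q ⁻¹' {y}) = {z} := by
  obtain ⟨a, rfl⟩ := hy
  refine ⟨(quotientMap hP hε hεβ)^[W.K] a, Subset.antisymm ?_ ?_⟩
  · rintro _ ⟨b, hb, rfl⟩
    exact quotientMap_iterate_K_eq hP hε hεβ (hq b a hb)
  · rintro _ rfl
    exact ⟨a, rfl, rfl⟩

end

end WielerPresolenoid

theorem mainTheorem1 {Y : Type*} [MetricSpace Y] [CompactSpace Y] (W : WielerPresolenoid Y)
    (P : Set W.Solenoid) (hfin : P.Finite) (hper : P ⊆ Function.periodicPts W.φ)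
    (hinv : W.φ '' P = P) (ε : ℝ) (hε : 0 < ε) (hεβ : ε ≤ W.β / 2) :
    Equivalence (W.Rel₀ P ε) ∧
    CompactSpace (W.Quotient₀ P ε) ∧
    LocallyHausdorff (W.Quotient₀ P ε) ∧
    ∃ g' : W.Quotient₀ P ε → W.Quotient₀ P ε,
      (∀ x : W.Unstable P, g' (Quot.mk _ x) = Quot.mk _ (x.map hinv)) ∧
      Function.Surjective g' ∧
      ForwardOrbitExpansive g' ∧
      IsLocalHomeomorph g' ∧
      ∃ L : ℕ,
        (∀ y ∈ Set.range (W.r P ε), ∃ z, g'^[L] '' (W.r P ε ⁻¹' {y}) = {z}) ∧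
        (∀ y : T2Quotient (W.Quotient₀ P ε), ∃ z, g'^[L] '' (T2Quotient.mk ⁻¹' {y}) = {z}) ∧
        (W.Irreducible → P.Nonempty →
          ∀ y : Y, ∃ z, g'^[L] '' (W.r P ε ⁻¹' {y}) = {z}) := by
  refine ⟨WielerPresolenoid.Rel₀_equivalence hε hεβ,
    WielerPresolenoid.compactSpace_quotient₀ hinv hε hεβ,
    WielerPresolenoid.locallyHausdorff_quotient₀ hε hεβ,
    WielerPresolenoid.quotientMap hinv hε hεβ, fun _ => rfl,
    WielerPresolenoid.surjective_quotientMap hinv hε hεβ,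
    WielerPresolenoid.forwardOrbitExpansive_quotientMap hinv hε hεβ,
    WielerPresolenoid.isLocalHomeomorph_quotientMap hinv hε hεβ, W.K, fun y hy => ?_,
    fun y => ?_, fun hirr hne y => ?_⟩
  · exact WielerPresolenoid.exists_image_iterate_eq_singleton hinv hε hεβ _ (fun _ _ => id) hy
  · refine WielerPresolenoid.exists_image_iterate_eq_singleton hinv hε hεβ _ (fun a b hab => ?_)
      (T2Quotient.surjective_mk _ y)
    -- The map `r` has a Hausdorff target, so it factors through the largest Hausdorff quotient.
    have h := congrArg (T2Quotient.lift (WielerPresolenoid.continuous_r (W := W) (P := P))) hab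
    rwa [T2Quotient.lift_mk, T2Quotient.lift_mk] at h
  · exact WielerPresolenoid.exists_image_iterate_eq_singleton hinv hε hεβ _ (fun _ _ => id)
      (WielerPresolenoid.surjective_r hinv hirr hne y)
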